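/- All maps below are arbitrary unless called continuous. Let $X$ be a topological space. A subset of $X$ is functionally closed if it is the zero set of a continuous function $X\to\mathbb R$, functionally open if its complement is functionally closed, and functionally $F_\sigma$ if it is a union of a sequence of functionally closed sets. A family $(U_i)_{i\in I}$ of subsets of $X$ is discrete if every point of $X$ has an open neighbourhood meeting $U_i$ for at most one $i\in I$; a family $(A_i)_{i\in I}$ of subsets of $X$ is strongly functionally discrete if there is a discrete family $(U_i)_{i\in I}$ of functionally open subsets of $X$ with $\overline{A_i}\subseteq U_i$ for all $i\in I$. For a topological space $Y$ and a map $f:X\to Y$ write - $f\in \mathrm{B}_1(X,Y)$ if $f$ is the pointwise limit of a sequence of continuous maps $X\to Y$; - $f\in \mathrm{K}_1(X,Y)$ if $f^{-1}(V)$ is functionally $F_\sigma$ in $X$ for every open $V\subseteq Y$; - $f\in \Sigma^f(X,Y)$ if there is a collection $\mathcal B=\bigcup_{n=1}^\infty\mathcal B_n$ of subsets of $X$, with each $\mathcal B_n$ strongly functionally discrete, such that for every open $V\subseteq Y$ the set $f^{-1}(V)$ is a union of members of $\mathcal B$. **Corollary.** Let $(Y_n)_{n=1}^\infty$ be a sequence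 of metrizable, connected, locally arcwise connected spaces, and let $Y\subseteq\prod_{n=1}^\infty Y_n$ be a subspace such that for every $n\ge 1$ there is a continuous map $h_n:\prod_{k=1}^n Y_k\to Y$ satisfying $p_n(h_n(y))=y$ for every $y\in\prod_{k=1}^n Y_k$, where $p_n:\prod_{m=1}^\infty Y_m\to\prod_{k=1}^n Y_k$, $p_n((y_m)_m)=(y_1,\dots,y_n)$, is the projection onto the first $n$ factors. Then, for every topological space $X$, $$\mathrm{K}_1(X,Y)\cap\Sigma^f(X,Y)=\mathrm{B}_1(X,Y).$$ -/

import Mathlib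

open Set Filter Topology

namespace BaireClassification

universe u v

variable {X : Type u} [TopologicalSpace X]

/-- A functionally closed set (zero set): the zero locus of a continuous real function. -/
def IsFunctionallyClosed (A : Set X) : Prop :=
  ∃ φ : C(X, ℝ), A = φ ⁻¹' {0}

/-- A functionally open set (cozero set): the complement of a functionally closed set. -/
def IsFunctionallyOpen (A : Set X) : Prop :=
  IsFunctionallyClosed Aᶜ

/-- A functionally `F_σ` set: the union of a sequence of functionally closed sets. -/
def IsFunctionallyFσ (A : Set X) : Prop :=
  ∃ F : ℕ → Set X, (∀ n, IsFunctionallyClosed (F n)) ∧ A = ⋃ n, F n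

/-- An indexed family of sets is discrete if every point has an open neighbourhood which meets
`A i` for at most one index `i`. -/
def IsDiscreteFamily {I : Type*} (A : I → Set X) : Prop :=
  ∀ x : X, ∃ W : Set X, IsOpen W ∧ x ∈ W ∧ {i | (A i ∩ W).Nonempty}.Subsingleton

/-- A strongly functionally discrete family of sets. -/
def IsStronglyFunctionallyDiscrete {I : Type*} (A : I → Set X) : Prop :=
  ∃ U : I → Set X, IsDiscreteFamily U ∧ (∀ i, IsFunctionallyOpen (U i)) ∧
    ∀ i, closure (A i) ⊆ U i

/-- A `σ`-strongly functionally discrete collection of sets: a union of countably many collections,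
each of which (indexed by its own members) is strongly functionally discrete. -/
def IsSigmaStronglyFunctionallyDiscrete (𝓑 : Set (Set X)) : Prop :=
  ∃ 𝓐 : ℕ → Set (Set X), 𝓑 = ⋃ n, 𝓐 n ∧
    ∀ n, IsStronglyFunctionallyDiscrete (fun A : 𝓐 n => (A : Set X))

variable {Y : Type v} [TopologicalSpace Y]

/-- A base for a mapping `f : X → Y`: the preimage of every open set is a union of members. -/
def IsBaseFor (𝓑 : Set (Set X)) (f : X → Y) : Prop :=
  ∀ V : Set Y, IsOpen V → ∃ 𝓒 : Set (Set X), 𝓒 ⊆ 𝓑 ∧ f ⁻¹' V = ⋃₀ 𝓒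

variable (X Y)

/-- The first Baire class `B₁(X, Y)`: pointwise limits of sequences of continuous mappings. -/
def B₁ : Set (X → Y) :=
  {f | ∃ g : ℕ → X → Y, (∀ n, Continuous (g n)) ∧
    ∀ x, Tendsto (fun n => g n x) atTop (𝓝 (f x))}

/-- The first functional Lebesgue class `K₁(X, Y)`: preimages of open sets are functionally
`F_σ`. -/
def K₁ : Set (X → Y) :=
  {f | ∀ V : Set Y, IsOpen V → IsFunctionallyFσ (f ⁻¹' V)}

/-- The class `Σᶠ(X, Y)` of mappings that have a `σ`-strongly functionally discrete base. -/
def SigmaF : Set (X → Y) :=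
  {f | ∃ 𝓑 : Set (Set X), IsSigmaStronglyFunctionallyDiscrete 𝓑 ∧ IsBaseFor 𝓑 f}

end BaireClassification

/-! Limits of continuous maps into a pseudometrizable space lie in both classes: if `g n → f`
pointwise, `f ⁻¹' V` is a countable union of sets on which a whole tail of the `g n` stays well
inside `V`. These are zero sets, and letting `V` run over Stone's σ-discrete covers gives the base
(`B₁_subset_K₁`, `B₁_subset_SigmaF`).

The converse is first proved for a path connected, locally path connected target
(`K₁_inter_SigmaF_subset_B₁`). At each scale `(1/2)^n`, the two classes give a cover of `X` on whose
pieces `f` is joined to a fixed centre by short paths; the cover is exhausted by increasing stages,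
each with discrete cozero envelopes. At stage `N` a constant map is pushed along paths from centre
to centre through scales `0, …, N - 1`; the displacements form a geometric series.

Both classes survive composition with coordinate projections, so each coordinate of `f` is a limit.
The sections `h n` turn the first coordinate approximations into maps to `Y`, and convergence in `Y`
is coordinatewise. -/

namespace BaireClassification

/-! ### Zero sets and cozero sets. -/

section FunctionallyClosed

variable {X Y : Type*} [TopologicalSpace X] [TopologicalSpace Y]

theorem isFunctionallyClosed_setOf_eq_zero {φ : X → ℝ} (hφ : Continuous φ) :
    IsFunctionallyClosed {x | φ x = 0} :=
  ⟨⟨φ, hφ⟩, rfl⟩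

theorem IsFunctionallyClosed.preimage {A : Set Y} (h : IsFunctionallyClosed A) {g : X → Y}
    (hg : Continuous g) : IsFunctionallyClosed (g ⁻¹' A) := by
  obtain ⟨φ, rfl⟩ := h
  exact isFunctionallyClosed_setOf_eq_zero (φ.continuous.comp hg)

theorem IsFunctionallyOpen.preimage {A : Set Y} (h : IsFunctionallyOpen A) {g : X → Y}
    (hg : Continuous g) : IsFunctionallyOpen (g ⁻¹' A) :=
  IsFunctionallyClosed.preimage (A := Aᶜ) h hg

theorem isFunctionallyClosed_iInter {F : ℕ → Set X} (hF : ∀ n, IsFunctionallyClosed (F n)) :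
    IsFunctionallyClosed (⋂ n, F n) := by
  choose φ hφ using hF
  have hnn : ∀ n x, 0 ≤ min (|φ n x|) 1 * (1 / 2 : ℝ) ^ n := fun n x ↦ by positivity
  have hle : ∀ n x, min (|φ n x|) 1 * (1 / 2 : ℝ) ^ n ≤ (1 / 2 : ℝ) ^ n := fun n x ↦
    mul_le_of_le_one_left (by positivity) (min_le_right _ _)
  have hc : Continuous fun x ↦ ∑' n, min (|φ n x|) 1 * (1 / 2 : ℝ) ^ n :=
    continuous_tsum (fun n ↦ by fun_prop) summable_geometric_two fun n x ↦ by
      rw [Real.norm_of_nonneg (hnn n x)]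
      exact hle n x
  convert isFunctionallyClosed_setOf_eq_zero hc using 1
  ext x
  have hs : Summable fun n ↦ min (|φ n x|) 1 * (1 / 2 : ℝ) ^ n :=
    Summable.of_nonneg_of_le (fun n ↦ hnn n x) (fun n ↦ hle n x) summable_geometric_two
  have key : (∑' n, min (|φ n x|) 1 * (1 / 2 : ℝ) ^ n = 0) ↔ ∀ n, φ n x = 0 := by
    rw [← hs.hasSum_iff, hasSum_zero_iff_of_nonneg (fun n ↦ hnn n x), funext_iff]
    refine forall_congr' fun n ↦ ⟨fun h ↦ ?_, fun h ↦ by simp [h]⟩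
    by_contra h0
    have : 0 < min (|φ n x|) 1 * (1 / 2 : ℝ) ^ n := by
      have := abs_pos.mpr h0
      positivity
    exact this.ne' h
  simp only [mem_iInter, hφ, mem_preimage, mem_singleton_iff, mem_ofPred_eq, key]

theorem isFunctionallyFσ_iUnion {ι : Type*} [Countable ι] [Nonempty ι] {F : ι → Set X}
    (hF : ∀ i, IsFunctionallyClosed (F i)) : IsFunctionallyFσ (⋃ i, F i) := by
  obtain ⟨e, he⟩ := exists_surjective_nat ι
  exact ⟨F ∘ e, fun n ↦ hF _, (he.iUnion_comp F).symm⟩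

theorem _root_.IsClosed.isFunctionallyClosed {Y : Type*} [PseudoMetricSpace Y] {A : Set Y}
    (hA : IsClosed A) : IsFunctionallyClosed A := by
  rcases A.eq_empty_or_nonempty with rfl | hne
  · exact ⟨ContinuousMap.const _ 1, by ext; simp⟩
  · convert isFunctionallyClosed_setOf_eq_zero (Metric.continuous_infDist_pt A) using 1
    ext x
    exact hA.mem_iff_infDist_zero hne

theorem _root_.IsOpen.isFunctionallyOpen {Y : Type*} [PseudoMetricSpace Y] {A : Set Y}
    (hA : IsOpen A) : IsFunctionallyOpen A :=
  hA.isClosed_compl.isFunctionallyClosed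

end FunctionallyClosed

/-! ### Discrete families and Stone's theorem. -/

section Discrete

variable {X Y : Type*} [TopologicalSpace X] [TopologicalSpace Y]

theorem IsDiscreteFamily.preimage {ι : Type*} {A : ι → Set Y} (h : IsDiscreteFamily A) {g : X → Y}
    (hg : Continuous g) : IsDiscreteFamily fun i ↦ g ⁻¹' A i := fun x ↦ by
  obtain ⟨W, hW, hx, hs⟩ := h (g x)
  exact ⟨g ⁻¹' W, hW.preimage hg, hx, hs.anti fun i ⟨y, hy⟩ ↦ ⟨g y, hy⟩⟩

theorem IsDiscreteFamily.mono {ι : Type*} {A B : ι → Set X} (h : IsDiscreteFamily A)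
    (hB : ∀ i, B i ⊆ A i) : IsDiscreteFamily B := fun x ↦ by
  obtain ⟨W, hW, hx, hs⟩ := h x
  exact ⟨W, hW, hx, hs.anti fun i hi ↦ hi.mono (inter_subset_inter_left _ (hB i))⟩

theorem IsDiscreteFamily.comp {ι κ : Type*} {A : ι → Set X} (h : IsDiscreteFamily A)
    {e : κ → ι} (he : Function.Injective e) : IsDiscreteFamily (A ∘ e) := fun x ↦ by
  obtain ⟨W, hW, hx, hs⟩ := h x
  exact ⟨W, hW, hx, fun i hi j hj ↦ he (hs hi hj)⟩

theorem IsDiscreteFamily.eq_of_mem {ι : Type*} {A : ι → Set X} (h : IsDiscreteFamily A) {i j : ι}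
    {x : X} (hi : x ∈ A i) (hj : x ∈ A j) : i = j := by
  obtain ⟨W, -, hx, hs⟩ := h x
  exact hs ⟨x, hi, hx⟩ ⟨x, hj, hx⟩

theorem IsDiscreteFamily.prod {ι κ : Type*} {A : ι → Set X} {B : κ → Set X}
    (hA : IsDiscreteFamily A) (hB : IsDiscreteFamily B) :
    IsDiscreteFamily fun p : ι × κ ↦ A p.1 ∩ B p.2 := fun x ↦ by
  obtain ⟨V, hV, hxV, hsV⟩ := hA x
  obtain ⟨W, hW, hxW, hsW⟩ := hB x
  refine ⟨V ∩ W, hV.inter hW, ⟨hxV, hxW⟩, ?_⟩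
  rintro ⟨i, j⟩ ⟨y, hy, hyV, hyW⟩ ⟨i', j'⟩ ⟨y', hy', hyV', hyW'⟩
  exact Prod.ext (hsV ⟨y, hy.1, hyV⟩ ⟨y', hy'.1, hyV'⟩) (hsW ⟨y, hy.2, hyW⟩ ⟨y', hy'.2, hyW'⟩)

theorem IsStronglyFunctionallyDiscrete.range {ι : Type*} {A : ι → Set X}
    (h : IsStronglyFunctionallyDiscrete A) :
    IsStronglyFunctionallyDiscrete fun B : Set.range A ↦ (B : Set X) := by
  obtain ⟨U, hU, ho, hA⟩ := h
  have he : ∀ B : Set.range A, A B.2.choose = B := fun B ↦ B.2.choose_spec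
  refine ⟨fun B ↦ U B.2.choose, hU.comp (e := fun B : Set.range A ↦ B.2.choose) fun B C h ↦ ?_,
    fun B ↦ ho _, fun B ↦ ?_⟩
  · exact Subtype.ext ((he B).symm.trans ((congrArg A h).trans (he C)))
  · have := hA B.2.choose
    rwa [he] at this

theorem isSigmaStronglyFunctionallyDiscrete_iUnion_range {κ ι : Type*} [Countable κ] [Nonempty κ]
    {A : κ → ι → Set X} (h : ∀ k, IsStronglyFunctionallyDiscrete (A k)) :
    IsSigmaStronglyFunctionallyDiscrete (⋃ k, Set.range (A k)) := by
  obtain ⟨e, he⟩ := exists_surjective_nat κ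
  exact ⟨fun n ↦ Set.range (A (e n)), (he.iUnion_comp fun k ↦ Set.range (A k)).symm,
    fun n ↦ (h (e n)).range⟩

/-- A. H. Stone's theorem: open covers of metric spaces have `σ`-discrete open refinements. -/
theorem exists_sigma_discrete_refinement {Y S : Type*} [PseudoMetricSpace Y] {U : S → Set Y}
    (hU : ∀ s, IsOpen (U s)) (hc : ∀ y, ∃ s, y ∈ U s) :
    ∃ V : ℕ → S → Set Y, (∀ n s, IsOpen (V n s)) ∧ (∀ n s, V n s ⊆ U s) ∧
      (∀ n, IsDiscreteFamily (V n)) ∧ ∀ y, ∃ n s, y ∈ V n s := by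
  obtain ⟨_, _⟩ := exists_wellFoundedLT S
  -- Points assigned to the least `s` covering them, with room `r = 1/(n+1)`. Distinct `E n s` are
  -- `r` apart, so after thickening by `r/3` a ball of radius `r/6` meets at most one.
  let E : ℕ → S → Set Y := fun n s ↦
    {x | Metric.ball x (1 / ((n : ℝ) + 1)) ⊆ U s ∧ ∀ t < s, x ∉ U t}
  have hr : ∀ n : ℕ, 0 < 1 / ((n : ℝ) + 1) := fun n ↦ by positivity
  have hE : ∀ n s t, s < t → ∀ x ∈ E n s, ∀ y ∈ E n t, 1 / ((n : ℝ) + 1) ≤ dist y x := by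
    intro n s t hst x hx y hy
    by_contra! h
    exact hy.2 s hst (hx.1 h)
  refine ⟨fun n s ↦ Metric.thickening (1 / ((n : ℝ) + 1) / 3) (E n s),
    fun n s ↦ Metric.isOpen_thickening, fun n s y hy ↦ ?_, fun n y ↦ ?_, fun y ↦ ?_⟩
  · obtain ⟨x, hx, hyx⟩ := Metric.mem_thickening_iff.mp hy
    exact hx.1 (Metric.mem_ball.mpr (hyx.trans (by linarith [hr n])))
  · have hr := hr n
    refine ⟨Metric.ball y (1 / ((n : ℝ) + 1) / 6), Metric.isOpen_ball,
      Metric.mem_ball_self (by positivity), ?_⟩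
    rintro s ⟨a, ha, hay⟩ t ⟨b, hb, hby⟩
    obtain ⟨a', ha', haa⟩ := Metric.mem_thickening_iff.mp ha
    obtain ⟨b', hb', hbb⟩ := Metric.mem_thickening_iff.mp hb
    rw [Metric.mem_ball] at hay hby
    have h1 : dist b' a' < 1 / ((n : ℝ) + 1) := by
      have h1 := dist_triangle4 b' b a a'
      have h2 := dist_triangle_right b a y
      rw [dist_comm b' b] at h1
      linarith
    rcases lt_trichotomy s t with h | h | h
    · exact absurd (hE n s t h a' ha' b' hb') h1.not_ge
    · exact h
    · rw [dist_comm] at h1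
      exact absurd (hE n t s h b' hb' a' ha') h1.not_ge
  · obtain ⟨s, hs, hmin⟩ := WellFounded.has_min (wellFounded_lt (α := S)) {s | y ∈ U s} (hc y)
    obtain ⟨ε, hε, hb⟩ := Metric.isOpen_iff.mp (hU s) y hs
    obtain ⟨n, hn⟩ := exists_nat_one_div_lt hε
    exact ⟨n, s, Metric.self_subset_thickening (by have := hr n; positivity) _
      ⟨(Metric.ball_subset_ball hn.le).trans hb, fun t ht hyt ↦ hmin t hyt ht⟩⟩

end Discrete

/-! ### Closed shrinkings of open sets. -/

section Shrink

variable {Y : Type*} [PseudoMetricSpace Y]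

theorem isClosed_setOf_ball_subset (V : Set Y) (r : ℝ) : IsClosed {y | Metric.ball y r ⊆ V} := by
  have : {y | Metric.ball y r ⊆ V} = (Metric.thickening r Vᶜ)ᶜ := by
    ext y
    simp only [mem_ofPred_eq, mem_compl_iff, Metric.mem_thickening_iff, not_exists, not_and,
      subset_def, Metric.mem_ball]
    refine forall_congr' fun z ↦ ?_
    rw [dist_comm]
    tauto
  rw [this]
  exact Metric.isOpen_thickening.isClosed_compl

theorem setOf_ball_subset_subset {V : Set Y} {r : ℝ} (hr : 0 < r) :
    {y | Metric.ball y r ⊆ V} ⊆ V := fun _ hy ↦ hy (Metric.mem_ball_self hr)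

theorem exists_setOf_ball_subset_mem_nhds {V : Set Y} (hV : IsOpen V) {y : Y} (hy : y ∈ V) :
    ∃ m : ℕ, {y | Metric.ball y (1 / ((m : ℝ) + 1)) ⊆ V} ∈ 𝓝 y := by
  obtain ⟨ε, hε, hb⟩ := Metric.isOpen_iff.mp hV y hy
  obtain ⟨m, hm⟩ := exists_nat_one_div_lt (half_pos hε)
  refine ⟨m, mem_of_superset (Metric.ball_mem_nhds y (half_pos hε)) fun z hz w hw ↦ hb ?_⟩
  rw [Metric.mem_ball] at *
  linarith [dist_triangle w z y]

variable {X : Type*}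

/-- The shrinkings are closed, so a tail lying in one keeps its limit there; conversely each point
of `V` is interior to some shrinking. -/
theorem preimage_eq_iUnion_of_tendsto {f : X → Y} {g : ℕ → X → Y}
    (hlim : ∀ x, Tendsto (fun n ↦ g n x) atTop (𝓝 (f x))) {V : Set Y} (hV : IsOpen V) :
    f ⁻¹' V = ⋃ q : ℕ × ℕ, ⋂ i : ℕ,
      g (i + q.2) ⁻¹' {y | Metric.ball y (1 / ((q.1 : ℝ) + 1)) ⊆ V} := by
  ext x
  simp only [mem_preimage, mem_iUnion, mem_iInter]
  constructor
  · intro hx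
    obtain ⟨m, hm⟩ := exists_setOf_ball_subset_mem_nhds hV hx
    obtain ⟨p, hp⟩ := eventually_atTop.mp ((hlim x).eventually hm)
    exact ⟨(m, p), fun i ↦ hp _ (Nat.le_add_left p i)⟩
  · rintro ⟨⟨m, p⟩, h⟩
    have h2 := (isClosed_setOf_ball_subset V (1 / ((m : ℝ) + 1))).mem_of_tendsto
      ((tendsto_add_atTop_iff_nat p).mpr (hlim x)) (Eventually.of_forall h)
    exact setOf_ball_subset_subset (by positivity) h2

end Shrink

/-! ### Baire-one maps lie in both classes. -/

theorem B₁_subset_K₁ (X Y : Type*) [TopologicalSpace X] [TopologicalSpace Y]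
    [TopologicalSpace.PseudoMetrizableSpace Y] : B₁ X Y ⊆ K₁ X Y := by
  let _ := TopologicalSpace.pseudoMetrizableSpacePseudoMetric Y
  rintro f ⟨g, hg, hlim⟩ V hV
  rw [preimage_eq_iUnion_of_tendsto hlim hV]
  exact isFunctionallyFσ_iUnion fun q ↦ isFunctionallyClosed_iInter fun i ↦
    (isClosed_setOf_ball_subset V _).isFunctionallyClosed.preimage (hg _)

theorem B₁_subset_SigmaF (X Y : Type*) [TopologicalSpace X] [TopologicalSpace Y]
    [TopologicalSpace.PseudoMetrizableSpace Y] : B₁ X Y ⊆ SigmaF X Y := by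
  let _ := TopologicalSpace.pseudoMetrizableSpacePseudoMetric Y
  rintro f ⟨g, hg, hlim⟩
  choose V hVo hVU hVd hVc using fun k : ℕ ↦
    exists_sigma_discrete_refinement (U := fun s : Y ↦ Metric.ball s (1 / ((k : ℝ) + 1)))
      (fun s ↦ Metric.isOpen_ball) fun y ↦ ⟨y, Metric.mem_ball_self (by positivity)⟩
  let A : ((ℕ × ℕ) × (ℕ × ℕ)) → Y → Set X := fun q s ↦
    ⋂ i : ℕ, g (i + q.2.2) ⁻¹' {y | Metric.ball y (1 / ((q.2.1 : ℝ) + 1)) ⊆ V q.1.1 q.1.2 s}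
  have hA : ∀ k n s, f ⁻¹' V k n s = ⋃ q : ℕ × ℕ, A ((k, n), q) s := fun k n s ↦
    preimage_eq_iUnion_of_tendsto hlim (hVo k n s)
  refine ⟨⋃ q, Set.range (A q), isSigmaStronglyFunctionallyDiscrete_iUnion_range fun q ↦ ?_, ?_⟩
  · refine ⟨fun s ↦ g q.2.2 ⁻¹' V q.1.1 q.1.2 s, (hVd _ _).preimage (hg _),
      fun s ↦ (hVo _ _ _).isFunctionallyOpen.preimage (hg _), fun s ↦ ?_⟩
    have hcl : IsClosed (A q s) := isClosed_iInter fun i ↦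
      (isClosed_setOf_ball_subset _ _).preimage (hg _)
    rw [hcl.closure_eq]
    intro x hx
    have := mem_iInter.mp hx 0
    rw [zero_add] at this
    change g q.2.2 x ∈ V q.1.1 q.1.2 s
    exact setOf_ball_subset_subset Nat.one_div_pos_of_nat (mem_preimage.mp this)
  · intro W hW
    refine ⟨{B ∈ ⋃ q, Set.range (A q) | B ⊆ f ⁻¹' W}, fun B hB ↦ hB.1,
      Subset.antisymm (fun x hx ↦ ?_) (sUnion_subset fun B hB ↦ hB.2)⟩
    obtain ⟨ε, hε, hb⟩ := Metric.isOpen_iff.mp hW (f x) hx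
    obtain ⟨k, hk⟩ := exists_nat_one_div_lt (half_pos hε)
    obtain ⟨n, s, hns⟩ := hVc k (f x)
    have hsub : V k n s ⊆ W := fun y hy ↦ hb <| by
      have h1 := hVU k n s hy
      have h2 := hVU k n s hns
      rw [Metric.mem_ball] at *
      linarith [dist_triangle_right y (f x) s]
    have hx' : x ∈ f ⁻¹' V k n s := hns
    rw [hA, mem_iUnion] at hx'
    obtain ⟨q, hq⟩ := hx'
    refine ⟨A ((k, n), q) s, ⟨mem_iUnion.mpr ⟨_, s, rfl⟩, ?_⟩, hq⟩
    exact (subset_iUnion (fun q ↦ A ((k, n), q) s) q).trans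
      ((hA k n s).symm.subset.trans (preimage_mono hsub))

/-! ### Modifying continuous maps on discrete families. -/

section Gluing

variable {X Z : Type*} [TopologicalSpace X] [TopologicalSpace Z]

/-- Continuous modifications of a map on the members of a discrete family can be glued. -/
theorem IsDiscreteFamily.exists_glue {ι : Type*} {U : ι → Set X} (hU : IsDiscreteFamily U)
    {g : X → Z} (hg : Continuous g) {u : ι → X → Z} (hu : ∀ i, Continuous (u i))
    (hug : ∀ i, ∀ x ∉ U i, u i x = g x) :
    ∃ g' : X → Z, Continuous g' ∧ (∀ i, ∀ x ∈ U i, g' x = u i x) ∧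
      ∀ x, (∀ i, x ∉ U i) → g' x = g x := by
  classical
  let g' : X → Z := fun x ↦ if h : ∃ i, x ∈ U i then u h.choose x else g x
  have h1 : ∀ i, ∀ x ∈ U i, g' x = u i x := fun i x hx ↦ by
    have h : ∃ i, x ∈ U i := ⟨i, hx⟩
    simp only [g', dif_pos h, hU.eq_of_mem h.choose_spec hx]
  have h2 : ∀ x, (∀ i, x ∉ U i) → g' x = g x := fun x hx ↦ by
    simp only [g', dif_neg (not_exists.mpr hx)]
  refine ⟨g', continuous_iff_continuousAt.mpr fun x ↦ ?_, h1, h2⟩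
  obtain ⟨W, hW, hx, hs⟩ := hU x
  by_cases hi : ∃ i, (U i ∩ W).Nonempty
  · obtain ⟨i, hi⟩ := hi
    refine (hu i).continuousAt.congr (mem_of_superset (hW.mem_nhds hx) fun y hy ↦ ?_)
    change u i y = g' y
    by_cases hyi : y ∈ U i
    · exact (h1 i y hyi).symm
    · rw [hug i y hyi, h2 y]
      intro j hj
      have : j = i := hs ⟨y, hj, hy⟩ hi
      exact hyi (this ▸ hj)
  · refine hg.continuousAt.congr (mem_of_superset (hW.mem_nhds hx) fun y hy ↦ ?_)
    exact (h2 y fun i hyi ↦ hi ⟨i, y, hyi, hy⟩).symm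

/-- Move a map along paths on a discrete family of cozero sets where it is locally constant. -/
theorem exists_continuous_along_paths {ι : Type*} {h : ι → X → ℝ} (hh : ∀ i, Continuous (h i))
    (hd : IsDiscreteFamily fun i ↦ {x | 0 < h i x}) {g : X → Z} (hg : Continuous g)
    {a b : ι → Z} (γ : ∀ i, Path (a i) (b i)) (hga : ∀ i x, 0 ≤ h i x → g x = a i) :
    ∃ g' : X → Z, Continuous g' ∧ (∀ x, (∀ i, h i x ≤ 0) → g' x = g x) ∧
      (∀ i x, 0 < h i x → g' x ∈ Set.range (γ i)) ∧ ∀ i x, 1 / 2 ≤ h i x → g' x = b i := by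
  classical
  let u : ι → X → Z := fun i x ↦ if 0 ≤ h i x then (γ i).extend (2 * h i x) else g x
  obtain ⟨g', hg', h1, h2⟩ := hd.exists_glue hg (u := u)
    (fun i ↦ Continuous.if_le ((γ i).continuous_extend.comp (continuous_const.mul (hh i))) hg
      continuous_const (hh i) fun x hx ↦ by
        rw [hga i x hx.le, ← hx, mul_zero, Path.extend_zero])
    (fun i x hx ↦ by
      have hx : h i x ≤ 0 := not_lt.mp hx
      by_cases h0 : 0 ≤ h i x
      · simp only [u, if_pos h0, le_antisymm hx h0, mul_zero, Path.extend_zero]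
        exact (hga i x h0).symm
      · simp only [u, if_neg h0])
  refine ⟨g', hg', fun x hx ↦ h2 x fun i ↦ not_lt.mpr (hx i), fun i x hx ↦ ?_, fun i x hx ↦ ?_⟩
  · rw [h1 i x hx]
    simp only [u, if_pos hx.le]
    rw [← (γ i).extend_range]
    exact mem_range_self _
  · have h0 : 0 < h i x := by linarith
    rw [h1 i x h0]
    simp only [u, if_pos h0.le]
    exact (γ i).extend_of_one_le (by linarith)

end Gluing

/-! ### Covers adapted to a map in both classes. -/

section Covers

variable {X : Type*} [TopologicalSpace X]

/-- Disjointification: a cover by sets `{ψ k i = 1}`, discrete in `i`, refines to a family of sets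
each of which is an increasing union of zero sets, with discreteness at every stage. -/
theorem exists_monotone_discrete_cover {ι : Type*} {ψ : ℕ → ι → X → ℝ}
    (hc : ∀ k i, Continuous (ψ k i)) (h0 : ∀ k i x, 0 ≤ ψ k i x) (h1 : ∀ k i x, ψ k i x ≤ 1)
    (hd : ∀ k, IsDiscreteFamily fun i ↦ {x | 0 < ψ k i x}) (hcov : ∀ x, ∃ k i, ψ k i x = 1) :
    ∃ φ : ℕ → ℕ × ι → X → ℝ, (∀ m j, Continuous (φ m j)) ∧
      (∀ m, IsDiscreteFamily fun j ↦ {x | 0 < φ m j x}) ∧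
      (∀ j x m m', m ≤ m' → 1 ≤ φ m j x → 1 ≤ φ m' j x) ∧
      (∀ x, ∃ j m, 1 ≤ φ m j x) ∧ ∀ m j x, 1 ≤ φ m j x → ψ j.1 j.2 x = 1 := by
  choose s hsc hsψ hs0 using fun k ↦ (hd k).exists_glue (g := fun _ ↦ (0 : ℝ)) continuous_const
    (hc k) fun i x hx ↦ le_antisymm (not_lt.mp hx) (h0 k i x)
  have hs : ∀ k x, 0 ≤ s k x ∧ s k x ≤ 1 := fun k x ↦ by
    by_cases hx : ∃ i, 0 < ψ k i x
    · obtain ⟨i, hi⟩ := hx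
      rw [hsψ k i x hi]
      exact ⟨h0 k i x, h1 k i x⟩
    · rw [hs0 k x (not_exists.mp hx)]
      exact ⟨le_rfl, zero_le_one⟩
  let P : ℕ → X → ℝ := fun k x ↦ ∏ l ∈ Finset.range k, (1 - s l x)
  have hPc : ∀ k, Continuous (P k) := fun k ↦
    continuous_finsetProd _ fun l _ ↦ continuous_const.sub (hsc l)
  have hP0 : ∀ k x, 0 ≤ P k x := fun k x ↦
    Finset.prod_nonneg fun l _ ↦ sub_nonneg.mpr (hs l x).2
  have hPs : ∀ k x, P (k + 1) x = P k x * (1 - s k x) := fun k x ↦ Finset.prod_range_succ _ _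
  have hPa : ∀ x, Antitone fun k ↦ P k x := fun x ↦ antitone_nat_of_succ_le fun k ↦ by
    rw [hPs]
    exact mul_le_of_le_one_right (hP0 k x) (by linarith [(hs k x).1])
  have hPz : ∀ x, P 0 x = 1 := fun x ↦ Finset.prod_range_zero _
  have hP1 : ∀ k x, P (k + 1) x ≤ 1 - s k x := fun k x ↦ by
    rw [hPs]
    exact mul_le_of_le_one_left (by linarith [(hs k x).2]) ((hPa x k.zero_le).trans (hPz x).le)
  -- `φ m (k, i) ≥ 1` means `ψ k i = 1` and `P k ≥ 1/(m+1)`. Positivity forces `P k > 2/(3(m+1))`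
  -- but `P (k+1) < 1/(3(m+1))`; this gap isolates one level `k` near each point.
  let φ : ℕ → ℕ × ι → X → ℝ := fun m j x ↦
    min (3 * ((m : ℝ) + 1) * (ψ j.1 j.2 x - 1) + 1) (3 * ((m : ℝ) + 1) * P j.1 x - 2)
  have hφ1 : ∀ m j x, 1 ≤ φ m j x ↔ ψ j.1 j.2 x = 1 ∧ 1 ≤ ((m : ℝ) + 1) * P j.1 x := by
    intro m j x
    have hm : (0 : ℝ) < 3 * ((m : ℝ) + 1) := by positivity
    simp only [φ, le_min_iff]
    refine and_congr ⟨fun h ↦ le_antisymm (h1 _ _ _) ?_, fun h ↦ by rw [h]; simp⟩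
      ⟨fun h ↦ by linarith, fun h ↦ by linarith⟩
    have : 0 ≤ ψ j.1 j.2 x - 1 := nonneg_of_mul_nonneg_right (by linarith) hm
    linarith
  refine ⟨φ, fun m j ↦ ?_, fun m x ↦ ?_, fun j x m m' hm h ↦ ?_, fun x ↦ ?_,
    fun m j x h ↦ ((hφ1 m j x).mp h).1⟩
  · have h2 := hc j.1 j.2
    have h3 := hPc j.1
    fun_prop
  · have hm : (0 : ℝ) < 3 * ((m : ℝ) + 1) := by positivity
    have hex : ∃ l, 3 * ((m : ℝ) + 1) * P (l + 1) x < 2 := by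
      obtain ⟨k, i, hki⟩ := hcov x
      refine ⟨k, ?_⟩
      have : P (k + 1) x = 0 := by
        rw [hPs, hsψ k i x (by simp [hki]), hki]
        simp
      rw [this]
      simp
    classical
    obtain ⟨l, hl, hmin⟩ : ∃ l, 3 * ((m : ℝ) + 1) * P (l + 1) x < 2 ∧
        1 < 3 * ((m : ℝ) + 1) * P l x := by
      refine ⟨Nat.find hex, Nat.find_spec hex, ?_⟩
      rcases hk : Nat.find hex with _ | k
      · rw [hPz]
        have : (0 : ℝ) ≤ m := by positivity
        linarith
      · have := Nat.find_min hex (m := k) (by omega)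
        linarith
    obtain ⟨W, hW, hxW, hsub⟩ := hd l x
    refine ⟨W ∩ ({y | 3 * ((m : ℝ) + 1) * P (l + 1) y < 2} ∩ {y | 1 < 3 * ((m : ℝ) + 1) * P l y}),
      hW.inter ((isOpen_lt (continuous_const.mul (hPc _)) continuous_const).inter
        (isOpen_lt continuous_const (continuous_const.mul (hPc _)))), ⟨hxW, hl, hmin⟩, ?_⟩
    have key : ∀ (j : ℕ × ι) (y : X), 0 < φ m j y → 3 * ((m : ℝ) + 1) * P (l + 1) y < 2 →
        1 < 3 * ((m : ℝ) + 1) * P l y → j.1 = l ∧ 0 < ψ j.1 j.2 y := by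
      rintro ⟨k, i⟩ y hy hy1 hy2
      simp only [φ, lt_min_iff] at hy
      obtain ⟨ha, hb⟩ := hy
      have hpos : 0 < ψ k i y := by
        by_contra h
        have : ψ k i y = 0 := le_antisymm (not_lt.mp h) (h0 _ _ _)
        rw [this] at ha
        have : (0 : ℝ) ≤ m := by positivity
        linarith
      refine ⟨?_, hpos⟩
      rcases lt_trichotomy k l with h | h | h
      · exfalso
        have h3 : P l y ≤ 1 - ψ k i y := by
          rw [← hsψ k i y hpos]
          exact (hPa y h).trans (hP1 k y)
        have := mul_le_mul_of_nonneg_left h3 hm.le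
        linarith
      · exact h
      · exfalso
        have := mul_le_mul_of_nonneg_left (hPa y h) hm.le
        simp only at this
        linarith
    rintro j ⟨y, hy, hyW, hy1, hy2⟩ j' ⟨y', hy', hyW', hy1', hy2'⟩
    obtain ⟨hjl, hj⟩ := key j y hy hy1 hy2
    obtain ⟨hjl', hj'⟩ := key j' y' hy' hy1' hy2'
    rw [hjl] at hj
    rw [hjl'] at hj'
    exact Prod.ext (hjl.trans hjl'.symm) (hsub ⟨y, hj, hyW⟩ ⟨y', hj', hyW'⟩)
  · rw [hφ1] at h ⊢
    refine ⟨h.1, h.2.trans (mul_le_mul_of_nonneg_right ?_ (hP0 _ _))⟩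
    have : (m : ℝ) ≤ m' := by exact_mod_cast hm
    linarith
  · classical
    let k := Nat.find (hcov x)
    obtain ⟨i, hi⟩ : ∃ i, ψ k i x = 1 := Nat.find_spec (hcov x)
    have hpos : 0 < P k x := Finset.prod_pos fun l hl ↦ by
      have hl : ¬∃ i, ψ l i x = 1 := Nat.find_min (hcov x) (Finset.mem_range.mp hl)
      rw [sub_pos]
      by_cases hx : ∃ i, 0 < ψ l i x
      · obtain ⟨i, hi⟩ := hx
        rw [hsψ l i x hi]
        exact lt_of_le_of_ne (h1 l i x) fun h ↦ hl ⟨i, h⟩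
      · rw [hs0 l x (not_exists.mp hx)]
        exact zero_lt_one
    obtain ⟨m, hm⟩ := exists_nat_one_div_lt hpos
    refine ⟨(k, i), m, (hφ1 _ _ _).mpr ⟨hi, ?_⟩⟩
    rw [div_lt_iff₀ (by positivity)] at hm
    change 1 ≤ ((m : ℝ) + 1) * P k x
    linarith

/-- Indexing by all subsets of `X` (empty envelopes off `𝓐`) gives every level the same index type.
-/
theorem IsStronglyFunctionallyDiscrete.exists_subset {𝓐 : Set (Set X)}
    (h : IsStronglyFunctionallyDiscrete fun A : 𝓐 ↦ (A : Set X)) :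
    ∃ U : Set X → Set X, IsDiscreteFamily U ∧ (∀ B, IsFunctionallyOpen (U B)) ∧
      ∀ B ∈ 𝓐, B ⊆ U B := by
  obtain ⟨U, hU, ho, hA⟩ := h
  refine ⟨fun B ↦ {x | ∃ h : B ∈ 𝓐, x ∈ U ⟨B, h⟩}, fun x ↦ ?_, fun B ↦ ?_,
    fun B hB x hx ↦ ⟨hB, hA ⟨B, hB⟩ (subset_closure hx)⟩⟩
  · obtain ⟨W, hW, hx, hs⟩ := hU x
    refine ⟨W, hW, hx, ?_⟩
    rintro B ⟨y, ⟨hB, hy⟩, hyW⟩ C ⟨y', ⟨hC, hy'⟩, hyW'⟩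
    exact congrArg Subtype.val (hs (x := ⟨B, hB⟩) ⟨y, hy, hyW⟩ (y := ⟨C, hC⟩) ⟨y', hy', hyW'⟩)
  · by_cases hB : B ∈ 𝓐
    · simpa [hB] using ho ⟨B, hB⟩
    · refine ⟨ContinuousMap.const _ 0, ?_⟩
      ext
      simp [hB]

variable {Z : Type*} [TopologicalSpace Z]

theorem exists_discrete_cover_of_mem {f : X → Z} (hK : f ∈ K₁ X Z) (hS : f ∈ SigmaF X Z)
    {N : Z → Set Z} (hNo : ∀ z, IsOpen (N z)) (hN : ∀ z, z ∈ N z) :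
    ∃ (ψ : ℕ → {B : Set X // ∃ z, B ⊆ f ⁻¹' N z} → X → ℝ)
      (z : {B : Set X // ∃ z, B ⊆ f ⁻¹' N z} → Z),
      (∀ k i, Continuous (ψ k i)) ∧ (∀ k i x, 0 ≤ ψ k i x) ∧ (∀ k i x, ψ k i x ≤ 1) ∧
      (∀ k, IsDiscreteFamily fun i ↦ {x | 0 < ψ k i x}) ∧ (∀ x, ∃ k i, ψ k i x = 1) ∧
      ∀ k i x, ψ k i x = 1 → f x ∈ N (z i) := by
  obtain ⟨_, ⟨𝓐, rfl, h𝓐⟩, hbase⟩ := hS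
  choose U hUd hUo hUs using fun n ↦ (h𝓐 n).exists_subset
  choose β hβ using hUo
  choose z hz using fun B : {B : Set X // ∃ z, B ⊆ f ⁻¹' N z} ↦ B.2
  choose F hF hFU using fun z ↦ hK (N z) (hNo z)
  choose α hα using hF
  obtain ⟨e, he⟩ := exists_surjective_nat (ℕ × ℕ × ℕ)
  -- `k` encodes `(n, p, q)`. The value is `1` exactly where `q|β| ≥ 1` and `α = 0`: the first
  -- condition keeps inside the discrete envelope, the second inside a zero set contained in `f ⁻¹'
  -- N (z B)`.
  refine ⟨fun k B x ↦ max 0 (min 1 (((e k).2.2 : ℝ) * |β (e k).1 B x|) - |α (z B) (e k).2.1 x|), z,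
    fun k B ↦ by fun_prop, fun k B x ↦ le_max_left _ _, fun k B x ↦ ?_, fun k ↦ ?_, fun x ↦ ?_,
    fun k B x h ↦ ?_⟩
  · refine max_le zero_le_one ?_
    linarith [min_le_left 1 (((e k).2.2 : ℝ) * |β (e k).1 B x|), abs_nonneg (α (z B) (e k).2.1 x)]
  · refine ((hUd (e k).1).comp Subtype.val_injective).mono fun B x hx ↦ ?_
    by_contra hxU
    have h0 : x ∈ β (e k).1 B ⁻¹' {0} := by
      rw [← hβ]
      exact hxU
    have h0 : β (e k).1 B x = 0 := h0
    simp only [mem_ofPred_eq, h0, abs_zero, mul_zero, lt_max_iff, lt_self_iff_false, false_or,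
      min_eq_right zero_le_one, zero_sub, Left.neg_pos_iff] at hx
    exact (abs_nonneg _).not_gt hx
  · obtain ⟨𝓒, h𝓒, hfC⟩ := hbase (N (f x)) (hNo _)
    have hx : x ∈ ⋃₀ 𝓒 := hfC ▸ hN (f x)
    obtain ⟨B, hB, hxB⟩ := hx
    obtain ⟨n, hn⟩ := mem_iUnion.mp (h𝓒 hB)
    let B' : {B : Set X // ∃ z, B ⊆ f ⁻¹' N z} := ⟨B, f x, hfC ▸ subset_sUnion_of_mem hB⟩
    have hxF : x ∈ f ⁻¹' N (z B') := hz B' hxB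
    rw [hFU, mem_iUnion] at hxF
    obtain ⟨p, hp⟩ := hxF
    rw [hα] at hp
    have hp : α (z B') p x = 0 := hp
    have hb : β n B x ≠ 0 := fun h ↦ by
      have : x ∈ β n B ⁻¹' {0} := h
      rw [← hβ] at this
      exact this (hUs n B hn hxB)
    obtain ⟨q, hq⟩ := exists_nat_gt (1 / |β n B x|)
    obtain ⟨k, hk⟩ := he (n, p, q)
    refine ⟨k, B', ?_⟩
    rw [div_lt_iff₀ (abs_pos.mpr hb)] at hq
    simp only [hk, hp, B', min_eq_left hq.le]
    simp
  · rw [← mem_preimage, hFU, mem_iUnion]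
    refine ⟨(e k).2.1, ?_⟩
    rw [hα]
    change α (z B) (e k).2.1 x = 0
    have h1 := min_le_left 1 (((e k).2.2 : ℝ) * |β (e k).1 B x|)
    have h2 := abs_nonneg (α (z B) (e k).2.1 x)
    beta_reduce at h
    rcases max_choice 0 (min 1 (((e k).2.2 : ℝ) * |β (e k).1 B x|) - |α (z B) (e k).2.1 x|) with
      h3 | h3
    · rw [h3] at h
      exact absurd h zero_ne_one
    · rw [h3] at h
      exact abs_eq_zero.mp (by linarith)

end Covers

/-! ### Approximation in path connected, locally path connected spaces. -/

section Approximation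

universe u

variable {X : Type u} [TopologicalSpace X] {Z : Type*} [PseudoMetricSpace Z]

theorem exists_joinedIn_ball_cover [LocallyPathConnectedSpace Z] {f : X → Z} (hK : f ∈ K₁ X Z)
    (hS : f ∈ SigmaF X Z) {ε : ℝ} (hε : 0 < ε) :
    ∃ (ι : Type u) (φ : ℕ → ι → X → ℝ) (z : ι → Z), (∀ m j, Continuous (φ m j)) ∧
      (∀ m, IsDiscreteFamily fun j ↦ {x | 0 < φ m j x}) ∧
      (∀ j x m m', m ≤ m' → 1 ≤ φ m j x → 1 ≤ φ m' j x) ∧ (∀ x, ∃ j m, 1 ≤ φ m j x) ∧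
      ∀ m j x, 1 ≤ φ m j x → JoinedIn (Metric.ball (z j) ε) (z j) (f x) := by
  choose P hP hPsub using fun z : Z ↦
    (LocallyPathConnectedSpace.path_connected_basis z).mem_iff.mp (Metric.ball_mem_nhds z hε)
  obtain ⟨ψ, z, hc, h0, h1, hd, hcov, hf⟩ := exists_discrete_cover_of_mem hK hS
    (N := fun z ↦ interior (P z)) (fun z ↦ isOpen_interior)
    fun z ↦ mem_interior_iff_mem_nhds.mpr (hP z).1
  obtain ⟨φ, hφc, hφd, hφm, hφcov, hφψ⟩ := exists_monotone_discrete_cover hc h0 h1 hd hcov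
  refine ⟨_, φ, fun j ↦ z j.2, hφc, hφd, hφm, hφcov, fun m j x h ↦ ?_⟩
  exact ((hP (z j.2)).2.joinedIn _ (mem_of_mem_nhds (hP (z j.2)).1) _
    (interior_subset (hf _ _ _ (hφψ m j x h)))).mono (hPsub _)

/-- A continuous map close to `f` at every point where the first few approximating covers are
realized; `h`, `c` record where the map is already constant. -/
theorem exists_continuous_approximation [PathConnectedSpace Z] {f : X → Z} {ι : ℕ → Type u}
    {φ : ∀ n, ι n → X → ℝ} {z : ∀ n, ι n → Z} (hφc : ∀ n j, Continuous (φ n j))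
    (hφd : ∀ n, IsDiscreteFamily fun j ↦ {x | 0 < φ n j x})
    (hφz : ∀ n j x, 1 ≤ φ n j x → JoinedIn (Metric.ball (z n j) ((1 / 2) ^ n)) (z n j) (f x))
    (N : ℕ) :
    ∃ (κ : Type u) (h : κ → X → ℝ) (c : κ → Z) (g : X → Z), (∀ i, Continuous (h i)) ∧
      IsDiscreteFamily (fun i ↦ {x | 0 < h i x}) ∧ Continuous g ∧
      (∀ i x, 1 / 2 ≤ h i x → g x = c i) ∧
      (∀ x, (∀ k < N, ∃ j, 1 ≤ φ k j x) → ∃ i, 1 ≤ h i x) ∧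
      (∀ i x, 1 ≤ h i x →
        JoinedIn {y | 1 ≤ N → dist y (c i) < 2 * (1 / 2) ^ N} (c i) (f x)) ∧
      ∀ n x, 1 ≤ n → n ≤ N → (∀ k < n, ∃ j, 1 ≤ φ k j x) →
        -- Equals `2 * (1/2)^N` at `n = N`; passing to `N + 1` raises it by `4 * (1/2)^N`, the
        -- length scale of the connecting paths. The guard `1 ≤ N` above exempts the arbitrary
        -- initial constant.
        dist (g x) (f x) ≤ 10 * (1 / 2) ^ n - 8 * (1 / 2) ^ N := by
  induction N with
  | zero =>
    obtain ⟨z₀⟩ := PathConnectedSpace.nonempty (X := Z)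
    refine ⟨PUnit, fun _ _ ↦ 1, fun _ ↦ z₀, fun _ ↦ z₀, fun _ ↦ continuous_const,
      fun x ↦ ⟨univ, isOpen_univ, mem_univ x, fun _ _ _ _ ↦ rfl⟩, continuous_const,
      fun _ _ _ ↦ rfl, fun _ _ ↦ ⟨⟨⟩, le_rfl⟩, fun _ x _ ↦ ?_, fun n x h1 h0 ↦ by omega⟩
    simpa using PathConnectedSpace.joined z₀ (f x)
  | succ N ih =>
    obtain ⟨κ, h, c, g, hhc, hhd, hg, hgc, hh1, hhf, hgf⟩ := ih
    have hr : (0 : ℝ) < (1 / 2) ^ N := by positivity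
    have hr' : ((1 : ℝ) / 2) ^ (N + 1) = (1 / 2) ^ N / 2 := by
      rw [pow_succ]
      ring
    classical
    -- A common point `x` lets the two centres be joined through `f x`.
    let R : κ × ι N → Prop := fun p ↦ ∃ x, 1 ≤ h p.1 x ∧ 1 ≤ φ N p.2 x
    let κ' := {p : κ × ι N // R p}
    -- `h' ≥ 0` forces `h ≥ 1/2`, where `g` is already constant, so a path can start there.
    let h' : κ' → X → ℝ := fun p x ↦ min (2 * h p.1.1 x - 1) (φ N p.1.2 x)
    have hh'c : ∀ p, Continuous (h' p) := fun p ↦ by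
      have h1 := hhc p.1.1
      have h2 := hφc N p.1.2
      fun_prop
    have hh'1 : ∀ p x, 1 ≤ h' p x ↔ 1 ≤ h p.1.1 x ∧ 1 ≤ φ N p.1.2 x := fun p x ↦ by
      simp only [h', le_min_iff]
      exact and_congr_left fun _ ↦ ⟨fun h ↦ by linarith, fun h ↦ by linarith⟩
    have hh'd : IsDiscreteFamily fun p ↦ {x | 0 < h' p x} :=
      ((hhd.prod (hφd N)).comp Subtype.val_injective).mono fun p x hx ↦ by
        have hx : 0 < 2 * h p.1.1 x - 1 ∧ 0 < φ N p.1.2 x := lt_min_iff.mp hx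
        have : 0 < h p.1.1 x := by linarith [hx.1]
        exact ⟨this, hx.2⟩
    have hjoin : ∀ p : κ', JoinedIn {y | 1 ≤ N → dist y (c p.1.1) < 4 * (1 / 2) ^ N}
        (c p.1.1) (z N p.1.2) := by
      rintro ⟨⟨i, j⟩, x, hix, hjx⟩
      have h1 := hhf i x hix
      have h2 := hφz N j x hjx
      refine (h1.mono ?_).trans (h2.symm.mono ?_)
      · intro y hy hN
        linarith [hy hN]
      · intro y hy hN
        have h3 := h1.target_mem hN
        have h4 := Metric.mem_ball.mp h2.target_mem
        have h5 := Metric.mem_ball.mp hy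
        have h6 := dist_triangle4 y (z N j) (f x) (c i)
        rw [dist_comm (z N j)] at h6
        linarith
    obtain ⟨g', hg', hgg, hgr, hgb⟩ := exists_continuous_along_paths hh'c hh'd hg
      (fun p ↦ (hjoin p).somePath) fun p x hx ↦ hgc p.1.1 x <| by
        have := (le_min_iff.mp hx).1
        linarith
    have hclose : 1 ≤ N → ∀ x, dist (g' x) (g x) ≤ 4 * (1 / 2) ^ N := by
      intro hN x
      by_cases hx : ∃ p, 0 < h' p x
      · obtain ⟨p, hp⟩ := hx
        obtain ⟨t, ht⟩ := hgr p x hp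
        rw [hgc p.1.1 x (by linarith [(lt_min_iff.mp hp).1]), ← ht]
        exact ((hjoin p).somePath_mem t hN).le
      · rw [hgg x fun p ↦ not_lt.mp (not_exists.mp hx p), dist_self]
        positivity
    have hcov' : ∀ x, (∀ k < N + 1, ∃ j, 1 ≤ φ k j x) → ∃ p, 1 ≤ h' p x := fun x hx ↦ by
      obtain ⟨i, hi⟩ := hh1 x fun k hk ↦ hx k (by omega)
      obtain ⟨j, hj⟩ := hx N (by omega)
      exact ⟨⟨(i, j), x, hi, hj⟩, (hh'1 _ _).mpr ⟨hi, hj⟩⟩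
    have hfar : ∀ p x, 1 ≤ h' p x →
        JoinedIn {y | 1 ≤ N + 1 → dist y (z N p.1.2) < 2 * (1 / 2) ^ (N + 1)}
          (z N p.1.2) (f x) := fun p x hx ↦
      (hφz N p.1.2 x ((hh'1 p x).mp hx).2).mono fun y hy _ ↦ by
        have := Metric.mem_ball.mp hy
        rw [hr']
        linarith
    refine ⟨κ', h', fun p ↦ z N p.1.2, g', hh'c, hh'd, hg', hgb, hcov', hfar, fun n x h1 hn hx ↦ ?_⟩
    rcases hn.eq_or_lt with rfl | hn
    · obtain ⟨p, hp⟩ := hcov' x hx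
      have h2 := (hfar p x hp).target_mem h1
      rw [hgb p x (by linarith), dist_comm]
      linarith
    · have hn : n ≤ N := by omega
      have h2 := hclose (h1.trans hn) x
      have h3 := hgf n x h1 hn hx
      have h4 := dist_triangle (g' x) (g x) (f x)
      rw [hr']
      linarith

theorem K₁_inter_SigmaF_subset_B₁ (X Z : Type*) [TopologicalSpace X] [TopologicalSpace Z]
    [TopologicalSpace.PseudoMetrizableSpace Z] [PathConnectedSpace Z]
    [LocallyPathConnectedSpace Z] : K₁ X Z ∩ SigmaF X Z ⊆ B₁ X Z := by
  let _ := TopologicalSpace.pseudoMetrizableSpacePseudoMetric Z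
  rintro f ⟨hK, hS⟩
  choose ι φ z hφc hφd hφm hφcov hφz using fun n : ℕ ↦
    exists_joinedIn_ball_cover hK hS (ε := (1 / 2) ^ n) (by positivity)
  -- Diagonal choice: `N` is both the number of scales and the stage of each cover.
  choose κ h c g _ _ hg _ _ _ hgf using fun N : ℕ ↦ exists_continuous_approximation
    (fun n j ↦ hφc n N j) (fun n ↦ hφd n N) (fun n j x ↦ hφz n N j x) N
  refine ⟨g, hg, fun x ↦ Metric.tendsto_atTop.mpr fun ε hε ↦ ?_⟩
  obtain ⟨n, hn⟩ := exists_pow_lt_of_lt_one (show 0 < ε / 10 by positivity)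
    (show (1 / 2 : ℝ) < 1 by norm_num)
  choose j m hjm using fun k ↦ hφcov k x
  refine ⟨max (n + 1) ((Finset.range (n + 1)).sup m), fun N hN ↦ ?_⟩
  have h1 := hgf N (n + 1) x (by omega) (le_of_max_le_left hN) fun k hk ↦
    ⟨j k, hφm k (j k) x _ _ ((Finset.le_sup (Finset.mem_range.mpr hk)).trans
      (le_of_max_le_right hN)) (hjm k)⟩
  have h2 : (0 : ℝ) < (1 / 2) ^ N := by positivity
  have h3 : ((1 : ℝ) / 2) ^ (n + 1) ≤ (1 / 2) ^ n :=
    pow_le_pow_of_le_one (by norm_num) (by norm_num) n.le_succ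
  linarith

end Approximation

/-! ### Passage to coordinates and the corollary. -/

section Composition

variable {X Y Z : Type*} [TopologicalSpace X] [TopologicalSpace Y] [TopologicalSpace Z]

theorem comp_mem_K₁ {f : X → Y} (hf : f ∈ K₁ X Y) {p : Y → Z} (hp : Continuous p) :
    p ∘ f ∈ K₁ X Z := fun V hV ↦ hf (p ⁻¹' V) (hV.preimage hp)

theorem comp_mem_SigmaF {f : X → Y} (hf : f ∈ SigmaF X Y) {p : Y → Z} (hp : Continuous p) :
    p ∘ f ∈ SigmaF X Z := by
  obtain ⟨𝓑, h𝓑, hb⟩ := hf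
  exact ⟨𝓑, h𝓑, fun V hV ↦ hb (p ⁻¹' V) (hV.preimage hp)⟩

end Composition

end BaireClassification

theorem mainTheorem8 {X : Type*} [TopologicalSpace X]
    (Z : ℕ → Type*) [∀ n, TopologicalSpace (Z n)]
    [∀ n, TopologicalSpace.MetrizableSpace (Z n)]
    [∀ n, PreconnectedSpace (Z n)] [∀ n, LocallyPathConnectedSpace (Z n)]
    (Y : Set (∀ n, Z n))
    (hY : ∀ n : ℕ, ∃ h : (∀ k : Fin (n + 1), Z k) → Y, Continuous h ∧
      ∀ (y : ∀ k : Fin (n + 1), Z k) (k : Fin (n + 1)), (h y : ∀ m, Z m) k = y k) :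
    BaireClassification.K₁ X Y ∩ BaireClassification.SigmaF X Y =
      BaireClassification.B₁ X Y := by
  have : TopologicalSpace.PseudoMetrizableSpace Y := by
    let _ := fun n ↦ TopologicalSpace.pseudoMetrizableSpacePseudoMetric (Z n)
    infer_instance
  refine Subset.antisymm (fun f hf ↦ ?_) fun f hf ↦
    ⟨BaireClassification.B₁_subset_K₁ X Y hf, BaireClassification.B₁_subset_SigmaF X Y hf⟩
  -- A point of `X` is needed to make every factor nonempty, hence path connected.
  rcases isEmpty_or_nonempty X with hX | ⟨⟨x₀⟩⟩
  · exact ⟨fun _ ↦ f, fun _ ↦ continuous_of_const fun x ↦ hX.elim x, fun x ↦ hX.elim x⟩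
  have hcoord : ∀ k, (fun x ↦ (f x : ∀ m, Z m) k) ∈ BaireClassification.B₁ X (Z k) := fun k ↦ by
    have : Nonempty (Z k) := ⟨(f x₀ : ∀ m, Z m) k⟩
    have : ConnectedSpace (Z k) := ⟨this⟩
    have : PathConnectedSpace (Z k) := pathConnectedSpace_iff_connectedSpace.mpr this
    have hp : Continuous fun y : Y ↦ (y : ∀ m, Z m) k :=
      (continuous_apply k).comp continuous_subtype_val
    exact BaireClassification.K₁_inter_SigmaF_subset_B₁ X (Z k)
      ⟨BaireClassification.comp_mem_K₁ hf.1 hp, BaireClassification.comp_mem_SigmaF hf.2 hp⟩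
  choose g hg hlim using hcoord
  choose h hh hhp using hY
  refine ⟨fun n x ↦ h n fun k ↦ g k n x, fun n ↦ (hh n).comp (continuous_pi fun k ↦ hg k n),
    fun x ↦ tendsto_subtype_rng.mpr (tendsto_pi_nhds.mpr fun k ↦ ?_)⟩
  -- `h n` preserves coordinates `0, …, n`, so coordinate `k` is exact once `n ≥ k`.
  refine (hlim k x).congr' (eventually_atTop.mpr ⟨k, fun n hn ↦ ?_⟩)
  exact (hhp n (fun k ↦ g k n x) ⟨k, by omega⟩).symm
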